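/- For integers $n\ge 1$ and $i\ge 0$ let $\Gamma_i=\Gamma_i^{\left[2\atop{\vdots\atop 2}\right]\times 9}$ be the number of matrices of rank $i$ over $\mathbb{F}_2$ among the $2n\times 9$ matrices obtained by stacking $n$ Hankel (persymmetric) blocks $$\begin{pmatrix}\alpha_1^{(j)}&\alpha_2^{(j)}&\cdots&\alpha_9^{(j)}\\ \alpha_2^{(j)}&\alpha_3^{(j)}&\cdots&\alpha_{10}^{(j)}\end{pmatrix},\qquad \alpha_m^{(j)}\in\mathbb{F}_2,\quad 1\le m\le 10,\ 1\le j\le n.$$ Then for every $n\ge 1$: $$\begin{aligned} \Gamma_0&=1,\\ \Gamma_1&=3\,(2^n-1),\\ \Gamma_2&=7\cdot2^{2n}+999\cdot2^n-1006,\\ \Gamma_3&=15\cdot2^{3n}+3451\cdot2^{2n}-10458\cdot2^n+6992,\\ \Gamma_4&=31\cdot2^{4n}+8355\cdot2^{3n}+111118\cdot2^{2n}-392304\cdot2^n+272800,\\ \Gamma_5&=63\cdot2^{5n}+17267\cdot2^{4n}+356190\cdot2^{3n}-3107440\cdot2^{2n}+6568032\cdot2^n-3834112,\\ \Gamma_6&=127\cdot2^{6n}+31059\cdot2^{5n}+492094\cdot2^{4n}-6658800\cdot2^{3n}+24491488\cdot2^{2n}-35215104\cdot2^n+16859136,\\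 \Gamma_7&=255\cdot2^{7n}+42291\cdot2^{6n}-219618\cdot2^{5n}-4053808\cdot2^{4n}+32840160\cdot2^{3n}-82168576\cdot2^{2n}\\&\quad+81543168\cdot2^n-27983872,\\ \Gamma_8&=511\cdot2^{8n}-765\cdot2^{7n}-127762\cdot2^{6n}+440496\cdot2^{5n}+8456800\cdot2^{4n}-57511680\cdot2^{3n}\\&\quad+118013952\cdot2^{2n}-83951616\cdot2^n+14680064,\\ \Gamma_9&=2^{10n}-511\cdot2^{8n}+510\cdot2^{7n}+85344\cdot2^{6n}-252000\cdot2^{5n}-4912384\cdot2^{4n}+30965760\cdot2^{3n}\\&\quad-57344000\cdot2^{2n}+31457280\cdot2^n. \end{aligned}$$ -/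

import Mathlib

/-- The `2n × k` matrix over `𝔽₂` obtained by stacking `n` Hankel (persymmetric) blocks of size
`2 × k`. The `j`-th block is built from the entries `α j 0, …, α j k`: its rows are
`(α j 0, …, α j (k - 1))` and `(α j 1, …, α j k)`. The row `(j, r)` is row `r` of block `j`. -/
def stackedHankel (n k : ℕ) (α : Fin n → Fin (k + 1) → ZMod 2) :
    Matrix (Fin n × Fin 2) (Fin k) (ZMod 2) :=
  fun p c => α p.1 ⟨p.2.val + c.val, by have h1 := p.2.isLt; have h2 := c.isLt; omega⟩

/-- A `2n × k` matrix over `𝔽₂` is `n`-times persymmetric if it consists of `n` stacked `2 × k`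
Hankel blocks. -/
def IsNTimesPersymmetric {n k : ℕ} (M : Matrix (Fin n × Fin 2) (Fin k) (ZMod 2)) : Prop :=
  ∃ α : Fin n → Fin (k + 1) → ZMod 2, M = stackedHankel n k α

/-- The number of `n`-times persymmetric `2n × k` matrices over `𝔽₂` of rank `i`. -/
noncomputable def persymmetricRankCount (n k i : ℕ) : ℕ :=
  {M : Matrix (Fin n × Fin 2) (Fin k) (ZMod 2) | IsNTimesPersymmetric M ∧ M.rank = i}.ncard

/-! Identify a column vector with a polynomial `p` of degree less than `k`, and block `j` with a
functional `α j` on polynomials of degree at most `k`. Then `p` lies in the kernel of the stacked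
matrix iff every `α j` kills `p` and `X * p`. For fixed `W` of dimension `d`, the `α` whose kernel
contains `W` number `(q ^ (k + 1 - dim (W + X W))) ^ n`, and `dim (W + X W) = 2 d - dim (shiftCore
W)`.

Counting pairs `W ≤ ker` in two ways expresses the Gaussian binomial moments of the kernel dimension
through `shiftCoreCount` (`sum_ncard_hankelKernel_mul`). These numbers satisfy a recursion in `m`,
because `W ≤ shiftCore U` iff `W + X W ≤ U` (`sum_shiftCoreCount_mul`). The matrix of Gaussian
binomials is unitriangular, so moments determine counts; this yields a closed form for
`shiftCoreCount` when `q = 2`, `m ≤ 9`, and then the rank counts. -/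

open Polynomial Module

/-! ### Gaussian binomial coefficients. -/

/-- The Gaussian binomial coefficient, evaluated at the natural number `q`. -/
def gaussBinom (q : ℕ) : ℕ → ℕ → ℕ
  | _, 0 => 1
  | 0, _ + 1 => 0
  | n + 1, k + 1 => gaussBinom q n k + q ^ (k + 1) * gaussBinom q n (k + 1)

theorem gaussBinom_succ_succ (q n k : ℕ) :
    gaussBinom q (n + 1) (k + 1) = gaussBinom q n k + q ^ (k + 1) * gaussBinom q n (k + 1) := rfl

theorem gaussBinom_eq_zero_of_lt (q : ℕ) {n k : ℕ} (h : n < k) : gaussBinom q n k = 0 := by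
  induction n generalizing k with
  | zero => obtain ⟨k, rfl⟩ := Nat.exists_eq_succ_of_ne_zero h.ne'; rfl
  | succ n ih =>
    obtain ⟨k, rfl⟩ := Nat.exists_eq_succ_of_ne_zero (Nat.ne_zero_of_lt h)
    rw [Nat.succ_eq_add_one, gaussBinom_succ_succ, ih (by omega), ih (by omega)]
    simp

theorem gaussBinom_self (q n : ℕ) : gaussBinom q n n = 1 := by
  induction n with
  | zero => rfl
  | succ n ih => rw [gaussBinom_succ_succ, ih, gaussBinom_eq_zero_of_lt q (Nat.lt_succ_self n), mul_zero, add_zero]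

theorem prod_pow_succ_sub_pow (q : ℤ) (n k : ℕ) :
    ∏ i ∈ Finset.range (k + 1), (q ^ (n + 1) - q ^ i) =
      (q ^ (n + 1) - 1) * q ^ k * ∏ i ∈ Finset.range k, (q ^ n - q ^ i) := by
  rw [Finset.prod_range_succ', mul_comm, pow_zero, mul_assoc]
  congr 1
  rw [← Finset.card_range k, ← Finset.prod_const, Finset.card_range, ← Finset.prod_mul_distrib]
  exact Finset.prod_congr rfl fun i _ => by ring

/-- The product formula without division. Over `ℤ` it also covers `k > n`, where the factor `i = n`
on the right vanishes. -/
theorem gaussBinom_mul_prod (q n k : ℕ) :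
    (gaussBinom q n k : ℤ) * ∏ i ∈ Finset.range k, ((q : ℤ) ^ k - q ^ i) =
      ∏ i ∈ Finset.range k, ((q : ℤ) ^ n - q ^ i) := by
  induction n generalizing k with
  | zero =>
    cases k with
    | zero => simp [gaussBinom]
    | succ k => simp [gaussBinom, Finset.prod_range_succ']
  | succ n ih =>
    cases k with
    | zero => simp [gaussBinom]
    | succ k =>
      have h1 := ih k
      have h2 := ih (k + 1)
      rw [Finset.prod_range_succ _ k] at h2
      rw [prod_pow_succ_sub_pow, gaussBinom_succ_succ]
      have h3 := prod_pow_succ_sub_pow (q : ℤ) k k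
      rw [Finset.prod_range_succ] at h3
      rw [h3] at h2
      rw [prod_pow_succ_sub_pow]
      rw [Finset.prod_range_succ] at h2
      push_cast
      linear_combination ((q : ℤ) ^ (k + 1) - 1) * q ^ k * h1 + (q : ℤ) ^ (k + 1) * h2

theorem finrank_map_mkQ_add_finrank {F V : Type*} [Field F]
    [AddCommGroup V] [Module F V] (E U : Submodule F V) [Module.Finite F U] (h : E ≤ U) :
    finrank F (U.map E.mkQ) + finrank F E = finrank F U := by
  have := LinearMap.finrank_range_add_finrank_ker (E.mkQ.domRestrict U)
  rw [LinearMap.range_domRestrict, LinearMap.ker_domRestrict, Submodule.ker_mkQ] at this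
  rwa [← Submodule.submoduleOf, (Submodule.submoduleOfEquivOfLe h).finrank_eq] at this

/-! ### Counting subspaces over a finite field. -/

section Subspaces

variable {F V : Type*} [Field F] [Fintype F] [AddCommGroup V] [Module F V]

/-- The number of linearly independent `k`-tuples. -/
theorem card_linearIndependent_int [Finite V] (k : ℕ) :
    (Nat.card {s : Fin k → V // LinearIndependent F s} : ℤ) =
      ∏ i ∈ Finset.range k, ((Fintype.card F : ℤ) ^ finrank F V - (Fintype.card F : ℤ) ^ i) := by
  have := Fintype.ofFinite V
  rcases le_or_gt k (finrank F V) with hk | hk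
  · rw [card_linearIndependent hk, Nat.cast_prod, Finset.prod_range]
    refine Finset.prod_congr rfl fun i _ => ?_
    rw [Nat.cast_sub (Nat.pow_le_pow_right Fintype.card_pos (by omega))]
    push_cast
    rfl
  · rw [Finset.prod_eq_zero (Finset.mem_range.mpr hk) (sub_self _)]
    have : IsEmpty {s : Fin k → V // LinearIndependent F s} :=
      ⟨fun s => by
        have := s.2.fintype_card_le_finrank
        rw [Fintype.card_fin] at this
        omega⟩
    simp

/-- Linearly independent `k`-tuples, fibred over the `k`-dimensional subspaces they span. -/
noncomputable def sigmaEquivLinearIndependent [Finite V] (k : ℕ) :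
    (Σ U : {U : Submodule F V // finrank F U = k}, {s : Fin k → U.1 // LinearIndependent F s}) ≃
      {s : Fin k → V // LinearIndependent F s} :=
  Equiv.ofBijective
    (fun x => ⟨fun i => x.2.1 i, x.2.2.map' _ (Submodule.ker_subtype _)⟩) <| by
    have hspan : ∀ (U : Submodule F V) (s : Fin k → U), finrank F U = k → LinearIndependent F s →
        Submodule.span F (Set.range fun i => (s i : V)) = U := by
      intro U s hU hs
      refine Submodule.eq_of_le_of_finrank_eq ?_ ?_
      · rw [Submodule.span_le]
        rintro _ ⟨i, rfl⟩
        exact (s i).2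
      · exact (finrank_span_eq_card (hs.map' U.subtype (Submodule.ker_subtype _))).trans
          ((Fintype.card_fin k).trans hU.symm)
    constructor
    · rintro ⟨⟨U, hU⟩, s, hs⟩ ⟨⟨U', hU'⟩, s', hs'⟩ h
      have h' : (fun i => (s i : V)) = fun i => (s' i : V) := congrArg Subtype.val h
      obtain rfl : U = U' := by rw [← hspan U s hU hs, ← hspan U' s' hU' hs', h']
      obtain rfl : s = s' := funext fun i => Subtype.ext (congrFun h' i)
      rfl
    · rintro ⟨s, hs⟩
      refine ⟨⟨⟨Submodule.span F (Set.range s), ?_⟩,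
        ⟨fun i => ⟨s i, Submodule.subset_span ⟨i, rfl⟩⟩, ?_⟩⟩, rfl⟩
      · rw [finrank_span_eq_card hs, Fintype.card_fin]
      · exact LinearIndependent.of_comp (Submodule.subtype _) hs

/-- Every independent `k`-tuple is a basis of exactly one `k`-dimensional subspace, and all these
subspaces have equally many bases. -/
theorem card_submodule_finrank_eq [Finite V] (k : ℕ) :
    Nat.card {U : Submodule F V // finrank F U = k} =
      gaussBinom (Fintype.card F) (finrank F V) k := by
  have := Fintype.ofFinite {U : Submodule F V // finrank F U = k}
  have h := card_linearIndependent_int (F := F) (V := V) k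
  rw [Nat.card_congr (sigmaEquivLinearIndependent k).symm, Nat.card_sigma, Nat.cast_sum,
    Finset.sum_congr rfl fun U _ => (card_linearIndependent_int (F := F) (V := U.1) k).trans
      (by rw [U.2]), Finset.sum_const, ← gaussBinom_mul_prod (Fintype.card F) (finrank F V) k, nsmul_eq_mul] at h
  have hne : ∏ i ∈ Finset.range k, ((Fintype.card F : ℤ) ^ k - (Fintype.card F : ℤ) ^ i) ≠ 0 := by
    refine Finset.prod_ne_zero_iff.mpr fun i hi => sub_ne_zero.mpr fun h => ?_
    have := Nat.pow_right_injective Fintype.one_lt_card (by exact_mod_cast h : _ ^ k = _ ^ i)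
    exact (Finset.mem_range.mp hi).ne' this
  have := mul_right_cancel₀ hne h
  rw [Nat.card_eq_fintype_card, ← Finset.card_univ]
  exact_mod_cast this

theorem ncard_submodule_le (L : Submodule F V) [Finite L] (k : ℕ) :
    {U : Submodule F V | U ≤ L ∧ finrank F U = k}.ncard =
      gaussBinom (Fintype.card F) (finrank F L) k := by
  have himage : {U : Submodule F V | U ≤ L ∧ finrank F U = k} =
      Submodule.map L.subtype '' {U : Submodule F L | finrank F U = k} := by
    ext U
    constructor
    · rintro ⟨hU, rfl⟩
      refine ⟨U.submoduleOf L, (Submodule.submoduleOfEquivOfLe hU).finrank_eq, ?_⟩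
      rw [Submodule.submoduleOf, Submodule.map_comap_subtype, inf_eq_right.mpr hU]
    · rintro ⟨U, rfl, rfl⟩
      exact ⟨Submodule.map_subtype_le L U, Submodule.finrank_map_subtype_eq L U⟩
  rw [himage, Set.ncard_image_of_injective _
    (Submodule.map_injective_of_injective L.subtype_injective), ← card_submodule_finrank_eq,
    ← Nat.card_coe_set_eq]
  rfl

/-- The number of `d`-dimensional subspaces between `E` and `L`. -/
theorem ncard_submodule_between (E L : Submodule F V) [Finite L] (hEL : E ≤ L) (d : ℕ) :
    {U : Submodule F V | E ≤ U ∧ U ≤ L ∧ finrank F U = d}.ncard =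
      if finrank F E ≤ d then
        gaussBinom (Fintype.card F) (finrank F L - finrank F E) (d - finrank F E) else 0 := by
  have hfin : ∀ U : Submodule F V, U ≤ L → Module.Finite F U := fun U hU =>
    Module.Finite.of_injective _ (Submodule.inclusion_injective hU)
  split_ifs with hd
  -- Passing to the quotient by `E` reduces to counting subspaces of `L / E`.
  · have : Finite (L.map E.mkQ) := (Set.toFinite (L : Set V)).image E.mkQ
    have := hfin L le_rfl
    rw [← finrank_map_mkQ_add_finrank E L hEL, Nat.add_sub_cancel, ← ncard_submodule_le]
    refine Set.ncard_congr (fun U _ => U.map E.mkQ) ?_ ?_ ?_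
    · rintro U ⟨hEU, hUL, rfl⟩
      have := hfin U hUL
      exact ⟨Submodule.map_mono hUL, by rw [← finrank_map_mkQ_add_finrank E U hEU]; simp⟩
    · rintro U U' ⟨hEU, -, -⟩ ⟨hEU', -, -⟩ h
      have := congrArg (Submodule.comap E.mkQ) h
      rwa [Submodule.comap_map_mkQ, Submodule.comap_map_mkQ, sup_eq_right.mpr hEU,
        sup_eq_right.mpr hEU'] at this
    · rintro Q ⟨hQL, hQ⟩
      have hEQ : E ≤ Q.comap E.mkQ := Submodule.le_comap_mkQ E Q
      have hQmap : (Q.comap E.mkQ).map E.mkQ = Q :=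
        Submodule.map_comap_eq_of_surjective E.mkQ_surjective Q
      have hQL' : Q.comap E.mkQ ≤ L := by
        refine (Submodule.comap_mono hQL).trans ?_
        rw [Submodule.comap_map_mkQ, sup_eq_right.mpr hEL]
      have := hfin _ hQL'
      refine ⟨Q.comap E.mkQ, ⟨hEQ, hQL', ?_⟩, hQmap⟩
      rw [← finrank_map_mkQ_add_finrank E _ hEQ, hQmap, hQ]
      omega
  · convert Set.ncard_empty (Submodule F V)
    refine Set.eq_empty_of_forall_notMem fun U ⟨hEU, hUL, hU⟩ => hd ?_
    have := hfin U hUL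
    exact hU ▸ Submodule.finrank_mono hEU

end Subspaces

/-! ### Double counting and inversion. -/

theorem sum_eq_sum_range_fiber {A : Type*} {S : Set A} (hS : S.Finite) (f u : A → ℕ) (c : ℕ → ℕ)
    (M : ℕ) (hf : ∀ x ∈ S, f x < M) (hu : ∀ x ∈ S, u x = c (f x)) :
    ∑ x ∈ hS.toFinset, u x = ∑ k ∈ Finset.range M, {x | x ∈ S ∧ f x = k}.ncard * c k := by
  rw [← Finset.sum_fiberwise_of_maps_to (t := Finset.range M) (g := f)
    fun x hx => Finset.mem_range.mpr (hf x (hS.mem_toFinset.mp hx))]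
  refine Finset.sum_congr rfl fun k _ => ?_
  have hset : {x | x ∈ S ∧ f x = k} = (hS.toFinset.filter fun x => f x = k : Finset A) := by
    ext x; simp
  rw [hset, Set.ncard_coe_finset, ← smul_eq_mul, ← Finset.sum_const]
  refine Finset.sum_congr rfl fun x hx => ?_
  rw [Finset.mem_filter, hS.mem_toFinset] at hx
  rw [hu x hx.1, hx.2]

/-- Double counting of a relation whose two valencies depend only on numerical invariants. -/
theorem sum_fiber_mul_eq_sum_fiber_mul {A B : Type*} {S : Set A} {T : Set B} (hS : S.Finite)
    (hT : T.Finite) (r : A → B → Prop) (f : A → ℕ) (g : B → ℕ) (u v : ℕ → ℕ) (M N : ℕ)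
    (hf : ∀ x ∈ S, f x < M) (hg : ∀ y ∈ T, g y < N)
    (hu : ∀ x ∈ S, {y | y ∈ T ∧ r x y}.ncard = u (f x))
    (hv : ∀ y ∈ T, {x | x ∈ S ∧ r x y}.ncard = v (g y)) :
    ∑ k ∈ Finset.range M, {x | x ∈ S ∧ f x = k}.ncard * u k =
      ∑ k ∈ Finset.range N, {y | y ∈ T ∧ g y = k}.ncard * v k := by
  classical
  rw [← sum_eq_sum_range_fiber hS f _ u M hf hu, ← sum_eq_sum_range_fiber hT g _ v N hg hv]
  convert Finset.sum_card_bipartiteAbove_eq_sum_card_bipartiteBelow r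
    (s := hS.toFinset) (t := hT.toFinset) using 2 with x hx y hy
  · rw [← Set.ncard_coe_finset]
    congr 1
    ext y
    simp [Finset.bipartiteAbove]
  · rw [← Set.ncard_coe_finset]
    congr 1
    ext x
    simp [Finset.bipartiteBelow]

/-- The system is unitriangular: in equation `j = k` the terms below `k` vanish and those above `k`
already agree, by descent from `D`. -/
theorem eq_of_sum_mul_gaussBinom_eq (q D : ℕ) (f g : ℕ → ℕ)
    (h : ∀ j ≤ D, ∑ k ∈ Finset.range (D + 1), f k * gaussBinom q k j =
      ∑ k ∈ Finset.range (D + 1), g k * gaussBinom q k j) :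
    ∀ k ≤ D, f k = g k := by
  intro k hk
  induction hn : D - k using Nat.strong_induction_on generalizing k with
  | _ n ih =>
    have hsum := h k hk
    rw [← Finset.add_sum_erase _ _ (Finset.mem_range.mpr (Nat.lt_succ_of_le hk)),
      ← Finset.add_sum_erase _ _ (Finset.mem_range.mpr (Nat.lt_succ_of_le hk)),
      Finset.sum_congr rfl fun i hi => ?_] at hsum
    · rw [gaussBinom_self, mul_one, mul_one] at hsum
      exact Nat.add_right_cancel hsum
    · rw [Finset.mem_erase, Finset.mem_range] at hi
      rcases lt_or_gt_of_ne hi.1 with hlt | hlt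
      · rw [gaussBinom_eq_zero_of_lt q hlt, mul_zero, mul_zero]
      · rw [ih (D - i) (by omega) i (by omega) rfl]

/-! ### Polynomial spaces and multiplication by `X`. -/

section Shift

variable {F : Type*} [Field F]

theorem X_mul_mem_degreeLT_succ {m : ℕ} {p : F[X]} :
    X * p ∈ degreeLT F (m + 1) ↔ p ∈ degreeLT F m := by
  simp only [mem_degreeLT, degree_lt_iff_coeff_zero]
  constructor
  · intro h i hi
    simpa using h (i + 1) (by omega)
  · intro h i hi
    obtain ⟨i, rfl⟩ := Nat.exists_eq_succ_of_ne_zero (show i ≠ 0 by omega)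
    simpa using h i (by omega)

/-- The polynomials `p ∈ U` with `X * p ∈ U`. -/
noncomputable def shiftCore (U : Submodule F F[X]) : Submodule F F[X] :=
  U ⊓ U.comap (LinearMap.mulLeft F X)

/-- The span of `W` and `X * W`. -/
noncomputable def shiftSpan (W : Submodule F F[X]) : Submodule F F[X] :=
  W ⊔ W.map (LinearMap.mulLeft F X)

/-- This adjunction lets the same pairs be counted from either side. -/
theorem le_shiftCore_iff {U W : Submodule F F[X]} : W ≤ shiftCore U ↔ shiftSpan W ≤ U := by
  rw [shiftCore, shiftSpan, le_inf_iff, sup_le_iff, Submodule.map_le_iff_le_comap]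

theorem shiftCore_le_degreeLT {U : Submodule F F[X]} {m : ℕ} (h : U ≤ degreeLT F (m + 1)) :
    shiftCore U ≤ degreeLT F m :=
  fun _ hp => X_mul_mem_degreeLT_succ.mp (h hp.2)

theorem shiftSpan_le_degreeLT {W : Submodule F F[X]} {m : ℕ} (h : W ≤ degreeLT F m) :
    shiftSpan W ≤ degreeLT F (m + 1) := by
  refine sup_le (h.trans (degreeLT_mono (Nat.le_succ m))) ?_
  rintro _ ⟨p, hp, rfl⟩
  exact X_mul_mem_degreeLT_succ.mpr (h hp)

/-- Multiplication by `X` is injective and `W ⊓ X W = X (shiftCore W)`. -/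
theorem finrank_shiftSpan (W : Submodule F F[X]) [Module.Finite F W] :
    finrank F (shiftSpan W) = 2 * finrank F W - finrank F (shiftCore W) := by
  have hinj : Function.Injective (LinearMap.mulLeft F (X : F[X])) :=
    fun p q h => mul_left_cancel₀ X_ne_zero h
  have h1 := Submodule.finrank_sup_add_finrank_inf_eq W (W.map (LinearMap.mulLeft F X))
  have h2 : W ⊓ W.map (LinearMap.mulLeft F X) = (shiftCore W).map (LinearMap.mulLeft F X) := by
    rw [shiftCore, Submodule.map_inf _ hinj, inf_comm W (W.map _), Submodule.map_comap_eq]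
    ext p
    simp only [Submodule.mem_inf, Submodule.mem_map, LinearMap.mem_range]
    tauto
  rw [h2, ← (Submodule.equivMapOfInjective _ hinj _).finrank_eq,
    ← (Submodule.equivMapOfInjective _ hinj _).finrank_eq] at h1
  rw [shiftSpan]
  omega

theorem finrank_degreeLT (m : ℕ) : finrank F (degreeLT F m) = m := by
  rw [(degreeLTEquiv F m).finrank_eq, finrank_fin_fun]

instance (m : ℕ) : Module.Finite F (degreeLT F m) :=
  Module.Finite.equiv (degreeLTEquiv F m).symm

theorem finite_of_le_degreeLT {U : Submodule F F[X]} {m : ℕ} (h : U ≤ degreeLT F m) :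
    Module.Finite F U :=
  Module.Finite.of_injective _ (Submodule.inclusion_injective h)

variable (F) in
/-- The number of `d`-dimensional spaces of polynomials of degree less than `m` whose `shiftCore`
has dimension `k`. -/
noncomputable def shiftCoreCount (m d k : ℕ) : ℕ :=
  {U : Submodule F F[X] | (U ≤ degreeLT F m ∧ finrank F U = d) ∧
    finrank F (shiftCore U) = k}.ncard

theorem finrank_shiftCore_le {U : Submodule F F[X]} {m d : ℕ}
    (h : U ≤ degreeLT F m ∧ finrank F U = d) : finrank F (shiftCore U) < d + 1 := by
  have := finite_of_le_degreeLT h.1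
  exact Nat.lt_succ_of_le (h.2 ▸ Submodule.finrank_mono inf_le_left)

theorem shiftCoreCount_eq_zero_of_lt {m d : ℕ} (h : m < d) (k : ℕ) :
    shiftCoreCount F m d k = 0 := by
  rw [shiftCoreCount]
  convert Set.ncard_empty (Submodule F F[X])
  refine Set.eq_empty_of_forall_notMem fun U hU => ?_
  have := Submodule.finrank_mono hU.1.1
  rw [finrank_degreeLT, hU.1.2] at this
  omega

theorem shiftCoreCount_zero_zero : shiftCoreCount F 0 0 0 = 1 := by
  rw [shiftCoreCount, Set.ncard_eq_one]
  refine ⟨⊥, Set.ext fun U => ⟨fun hU => ?_, ?_⟩⟩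
  · have := finite_of_le_degreeLT hU.1.1
    exact Submodule.finrank_eq_zero.mp hU.1.2
  · rintro rfl
    refine ⟨⟨bot_le, finrank_bot F F[X]⟩, ?_⟩
    rw [shiftCore, bot_inf_eq, finrank_bot]

variable [Fintype F]

instance (m : ℕ) : Finite (degreeLT F m) := Finite.of_equiv _ (degreeLTEquiv F m).toEquiv.symm

theorem finite_setOf_le_degreeLT (m d : ℕ) :
    {U : Submodule F F[X] | U ≤ degreeLT F m ∧ finrank F U = d}.Finite :=
  ((Set.finite_coe_iff.mp (inferInstanceAs (Finite (degreeLT F m)))).finite_subsets.preimage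
    SetLike.coe_injective.injOn).subset fun _ hU => hU.1

/-- Double counting of pairs `W ≤ shiftCore U` with `dim U = d`, `dim W = j`: given `W`, the
admissible `U` are those between `shiftSpan W` and `degreeLT F (m + 1)`. -/
theorem sum_shiftCoreCount_mul (m d j : ℕ) :
    ∑ k ∈ Finset.range (d + 1), shiftCoreCount F (m + 1) d k * gaussBinom (Fintype.card F) k j =
      ∑ i ∈ Finset.range (j + 1), shiftCoreCount F m j i *
        if 2 * j - i ≤ d then
          gaussBinom (Fintype.card F) (m + 1 - (2 * j - i)) (d - (2 * j - i)) else 0 := by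
  refine sum_fiber_mul_eq_sum_fiber_mul
    (finite_setOf_le_degreeLT (m + 1) d) (finite_setOf_le_degreeLT m j)
    (fun U W => W ≤ shiftCore U) (fun U => finrank F (shiftCore U))
    (fun W => finrank F (shiftCore W)) (fun k => gaussBinom (Fintype.card F) k j)
    (fun i => if 2 * j - i ≤ d then
          gaussBinom (Fintype.card F) (m + 1 - (2 * j - i)) (d - (2 * j - i)) else 0) _ _
    (fun U hU => finrank_shiftCore_le hU) (fun W hW => finrank_shiftCore_le hW) ?_ ?_
  · rintro U ⟨hU, -⟩
    have hle := shiftCore_le_degreeLT hU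
    have : Finite (shiftCore U) := Finite.of_injective _ (Submodule.inclusion_injective hle)
    rw [← ncard_submodule_le]
    congr 1
    ext W
    exact ⟨fun h => ⟨h.2, h.1.2⟩, fun h => ⟨⟨h.1.trans hle, h.2⟩, h.1⟩⟩
  · rintro W ⟨hW, rfl⟩
    have := finite_of_le_degreeLT hW
    have h := ncard_submodule_between (shiftSpan W) (degreeLT F (m + 1))
      (shiftSpan_le_degreeLT hW) d
    rw [finrank_degreeLT, finrank_shiftSpan] at h
    rw [← h]
    congr 1
    ext U
    simp only [Set.mem_ofPred_eq, le_shiftCore_iff]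
    tauto

end Shift

/-! ### Closed form for `q = 2`. -/

/-- The value of `shiftCoreCount` over a field with `q` elements. -/
def shiftCoreFormula (q m d k : ℕ) : ℕ :=
  q ^ ((d - k) * (d - k - 1)) * (gaussBinom q (d - 1) k * gaussBinom q (m + 1 - d) (d - k))

theorem sum_shiftCoreFormula_two : ∀ m < 9, ∀ d < m + 2, ∀ j < d + 1,
    ∑ k ∈ Finset.range (d + 1), shiftCoreFormula 2 (m + 1) d k * gaussBinom 2 k j =
      ∑ i ∈ Finset.range (j + 1), shiftCoreFormula 2 m j i *
        if 2 * j - i ≤ d then gaussBinom 2 (m + 1 - (2 * j - i)) (d - (2 * j - i)) else 0 := by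
  decide +kernel

/-- The count and the formula obey the same recursion, which determines its solution. The impossible
dimension `d = m + 1` is included because the recursion for `m + 1` uses every `j ≤ m + 1` at level
`m`. -/
theorem shiftCoreCount_zmod_two : ∀ m ≤ 9, ∀ d ≤ m + 1, ∀ k ≤ d,
    shiftCoreCount (ZMod 2) m d k = shiftCoreFormula 2 m d k := by
  intro m
  induction m with
  | zero =>
    intro _ d hd k hk
    interval_cases d
    · interval_cases k
      exact shiftCoreCount_zero_zero
    · rw [shiftCoreCount_eq_zero_of_lt one_pos]
      interval_cases k <;> rfl
  | succ m ih =>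
    intro hm d hd
    rcases Nat.lt_or_ge (m + 1) d with h | h
    · intro k hk
      obtain rfl : d = m + 2 := by omega
      rw [shiftCoreCount_eq_zero_of_lt h, shiftCoreFormula]
      rcases hk.eq_or_lt with rfl | hk
      · rw [gaussBinom_eq_zero_of_lt 2 (show m + 2 - 1 < m + 2 by omega)]; simp
      · rw [gaussBinom_eq_zero_of_lt 2 (show m + 1 + 1 - (m + 2) < m + 2 - k by omega)]; simp
    · refine eq_of_sum_mul_gaussBinom_eq 2 d _ _ fun j hj => ?_
      rw [sum_shiftCoreFormula_two m (by omega) d (by omega) j (by omega)]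
      have h2 := sum_shiftCoreCount_mul (F := ZMod 2) m d j
      rw [ZMod.card] at h2
      rw [h2]
      refine Finset.sum_congr rfl fun i hi => ?_
      rw [ih (by omega) j (by omega) i (by rw [Finset.mem_range] at hi; omega)]

/-! ### Hankel kernels as spaces of polynomials. -/

section Hankel

variable {F : Type*} [Field F]

/-- The functional on polynomials whose value at `X ^ c` is `a c` for `c ≤ k`. -/
noncomputable def coeffPairing (k : ℕ) : (Fin (k + 1) → F) →ₗ[F] Dual F F[X] where
  toFun a := ∑ c, a c • lcoeff F c
  map_add' a b := by simp [add_smul, Finset.sum_add_distrib]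
  map_smul' r a := by simp [Finset.smul_sum, mul_smul]

theorem coeffPairing_apply (k : ℕ) (a : Fin (k + 1) → F) (p : F[X]) :
    coeffPairing k a p = ∑ c, a c * p.coeff c := by
  simp [coeffPairing]

/-- The functionals on `degreeLT F (k + 1)` are the sequences of length `k + 1`. -/
noncomputable def coeffDualEquiv (k : ℕ) :
    (Fin (k + 1) → F) ≃ₗ[F] Dual F (degreeLT F (k + 1)) :=
  LinearEquiv.ofInjectiveOfFinrankEq
    ((degreeLT F (k + 1)).subtype.dualMap ∘ₗ coeffPairing k) (by
      intro a b h
      ext c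
      have hc : (X : F[X]) ^ (c : ℕ) ∈ degreeLT F (k + 1) := by
        rw [mem_degreeLT, degree_X_pow]
        exact_mod_cast c.2
      have := LinearMap.congr_fun h ⟨X ^ (c : ℕ), hc⟩
      simpa [coeffPairing_apply, coeff_X_pow, Fin.val_inj] using this)
    (by rw [Subspace.dual_finrank_eq, finrank_degreeLT, finrank_fin_fun])

theorem ncard_coeffPairing_eq_zero [Fintype F] (k : ℕ) (E : Submodule F F[X])
    (hE : E ≤ degreeLT F (k + 1)) :
    {a : Fin (k + 1) → F | ∀ p ∈ E, coeffPairing k a p = 0}.ncard =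
      Fintype.card F ^ (k + 1 - finrank F E) := by
  have hset : {a : Fin (k + 1) → F | ∀ p ∈ E, coeffPairing k a p = 0} =
      ((E.submoduleOf (degreeLT F (k + 1))).dualAnnihilator.comap
        (coeffDualEquiv k).toLinearMap : Submodule F (Fin (k + 1) → F)) := by
    ext a
    simp only [Set.mem_ofPred_eq, SetLike.mem_coe, Submodule.mem_comap,
      Submodule.mem_dualAnnihilator]
    exact ⟨fun h p hp => h p hp, fun h p hp => h ⟨p, hE hp⟩ hp⟩
  have hdual := Subspace.finrank_add_finrank_dualAnnihilator_eq
    (E.submoduleOf (degreeLT F (k + 1)))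
  rw [(Submodule.submoduleOfEquivOfLe hE).finrank_eq, finrank_degreeLT] at hdual
  rw [hset, ← Nat.card_coe_set_eq, SetLike.coe_sort_coe, Module.natCard_eq_pow_finrank (K := F),
    Nat.card_eq_fintype_card, Submodule.comap_equiv_eq_map_symm,
    LinearEquiv.finrank_map_eq]
  congr 1
  omega

/-- The polynomials of degree less than `k` annihilated, together with their products with `X`,
by all the functionals `α j`. -/
noncomputable def hankelKernel {n : ℕ} (k : ℕ) (α : Fin n → Fin (k + 1) → F) :
    Submodule F F[X] :=
  degreeLT F k ⊓ ⨅ j, shiftCore (LinearMap.ker (coeffPairing k (α j)))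

theorem le_hankelKernel_iff {n k : ℕ} {α : Fin n → Fin (k + 1) → F} {W : Submodule F F[X]}
    (hW : W ≤ degreeLT F k) :
    W ≤ hankelKernel k α ↔ ∀ j, ∀ p ∈ shiftSpan W, coeffPairing k (α j) p = 0 := by
  simp only [hankelKernel, le_inf_iff, hW, true_and, le_iInf_iff, le_shiftCore_iff]
  rfl

/-- The condition on `α` is imposed on each block separately, hence the `n`-th power. -/
theorem ncard_le_hankelKernel [Fintype F] (n k : ℕ) (W : Submodule F F[X])
    (hW : W ≤ degreeLT F k) :
    {α : Fin n → Fin (k + 1) → F | W ≤ hankelKernel k α}.ncard =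
      (Fintype.card F ^ (k + 1 - finrank F (shiftSpan W))) ^ n := by
  rw [← ncard_coeffPairing_eq_zero k _ (shiftSpan_le_degreeLT hW), ← Nat.card_coe_set_eq,
    ← Nat.card_coe_set_eq]
  have e : {α : Fin n → Fin (k + 1) → F | W ≤ hankelKernel k α} ≃
      (Fin n → {a : Fin (k + 1) → F | ∀ p ∈ shiftSpan W, coeffPairing k a p = 0}) :=
    (Equiv.subtypeEquivRight fun α => le_hankelKernel_iff hW).trans
      (Equiv.subtypePiEquivPi (p := fun _ a => ∀ p ∈ shiftSpan W, coeffPairing k a p = 0))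
  rw [Nat.card_congr e, Nat.card_fun, Nat.card_eq_fintype_card (α := Fin n), Fintype.card_fin]

theorem sum_ncard_hankelKernel_mul [Fintype F] (n k d : ℕ) :
    ∑ i ∈ Finset.range (k + 1),
      {α : Fin n → Fin (k + 1) → F | finrank F (hankelKernel k α) = i}.ncard *
        gaussBinom (Fintype.card F) i d =
      ∑ i ∈ Finset.range (d + 1), shiftCoreCount F k d i *
        (Fintype.card F ^ (k + 1 - (2 * d - i))) ^ n := by
  have h := sum_fiber_mul_eq_sum_fiber_mul (S := (Set.univ : Set (Fin n → Fin (k + 1) → F)))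
    (T := {U : Submodule F F[X] | U ≤ degreeLT F k ∧ finrank F U = d})
    Set.finite_univ (finite_setOf_le_degreeLT k d)
    (fun α W => W ≤ hankelKernel k α) (fun α => finrank F (hankelKernel k α))
    (fun W => finrank F (shiftCore W)) (fun i => gaussBinom (Fintype.card F) i d)
    (fun i => (Fintype.card F ^ (k + 1 - (2 * d - i))) ^ n) (k + 1) (d + 1)
    (fun α _ => ?_) (fun W hW => finrank_shiftCore_le hW) (fun α _ => ?_) ?_
  · simp only [Set.mem_univ, true_and] at h
    exact h
  · have := Submodule.finrank_mono (show hankelKernel k α ≤ degreeLT F k from inf_le_left)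
    rw [finrank_degreeLT] at this
    omega
  · have hle : hankelKernel k α ≤ degreeLT F k := inf_le_left
    have : Finite (hankelKernel k α) := Finite.of_injective _ (Submodule.inclusion_injective hle)
    rw [← ncard_submodule_le]
    congr 1
    ext W
    exact ⟨fun h => ⟨h.2, h.1.2⟩, fun h => ⟨⟨h.1.trans hle, h.2⟩, h.1⟩⟩
  · rintro W ⟨hW, rfl⟩
    have := finite_of_le_degreeLT hW
    rw [← finrank_shiftSpan, ← ncard_le_hankelKernel n k W hW]
    simp only [Set.mem_univ, true_and]

end Hankel

/-! ### From matrices to sequences. -/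

theorem stackedHankel_injective {n k : ℕ} (hk : 1 ≤ k) :
    Function.Injective (stackedHankel n k) := by
  intro α β h
  ext j c
  rcases Nat.eq_zero_or_pos c.val with hc | hc
  · have := congrFun (congrFun h (j, 0)) ⟨0, hk⟩
    simp only [stackedHankel] at this
    convert this using 2 <;> exact Fin.ext (by simp [hc])
  · have := congrFun (congrFun h (j, 1)) ⟨c.val - 1, by omega⟩
    simp only [stackedHankel] at this
    convert this using 2 <;> exact Fin.ext (by simp; omega)

theorem stackedHankel_mulVec {n k : ℕ} (α : Fin n → Fin (k + 1) → ZMod 2) (p : (ZMod 2)[X])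
    (hp : p ∈ degreeLT (ZMod 2) k) (j : Fin n) :
    (stackedHankel n k α).mulVec (degreeLTEquiv _ k ⟨p, hp⟩) (j, 0) = coeffPairing k (α j) p ∧
    (stackedHankel n k α).mulVec (degreeLTEquiv _ k ⟨p, hp⟩) (j, 1) =
      coeffPairing k (α j) (X * p) := by
  -- The pairing sums `k + 1` coefficients and a matrix row only `k`; the extra one is zero.
  have hpk : p.coeff k = 0 := by
    rw [mem_degreeLT] at hp
    exact coeff_eq_zero_of_degree_lt hp
  constructor
  · rw [coeffPairing_apply, Fin.sum_univ_castSucc]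
    simp only [Matrix.mulVec, dotProduct, stackedHankel, degreeLTEquiv, Fin.val_last, hpk]
    simp [Fin.castSucc, Fin.castAdd, Fin.castLE]
  · rw [coeffPairing_apply, Fin.sum_univ_succ]
    simp only [Matrix.mulVec, dotProduct, stackedHankel, degreeLTEquiv]
    simp [Fin.succ, add_comm]

theorem map_ker_stackedHankel {n k : ℕ} (α : Fin n → Fin (k + 1) → ZMod 2) :
    (LinearMap.ker ((stackedHankel n k α).mulVecLin ∘ₗ
      (degreeLTEquiv (ZMod 2) k).toLinearMap)).map (degreeLT (ZMod 2) k).subtype =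
        hankelKernel k α := by
  ext p
  simp only [hankelKernel, Submodule.mem_map, Submodule.mem_inf, Submodule.mem_iInf, shiftCore,
    Submodule.mem_comap, LinearMap.mem_ker, LinearMap.mulLeft_apply]
  constructor
  · rintro ⟨⟨p, hp⟩, h, rfl⟩
    refine ⟨hp, fun j => ⟨?_, ?_⟩⟩
    · exact (stackedHankel_mulVec α p hp j).1.symm.trans (congrFun h (j, 0))
    · exact (stackedHankel_mulVec α p hp j).2.symm.trans (congrFun h (j, 1))
  · rintro ⟨hp, h⟩
    refine ⟨⟨p, hp⟩, funext fun ⟨j, r⟩ => ?_, rfl⟩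
    fin_cases r
    · exact (stackedHankel_mulVec α p hp j).1.trans (h j).1
    · exact (stackedHankel_mulVec α p hp j).2.trans (h j).2

theorem rank_stackedHankel_add_finrank {n k : ℕ} (α : Fin n → Fin (k + 1) → ZMod 2) :
    (stackedHankel n k α).rank + finrank (ZMod 2) (hankelKernel k α) = k := by
  have h := LinearMap.finrank_range_add_finrank_ker
    ((stackedHankel n k α).mulVecLin ∘ₗ (degreeLTEquiv (ZMod 2) k).toLinearMap)
  rwa [← Submodule.finrank_map_subtype_eq, map_ker_stackedHankel, finrank_degreeLT,
    LinearMap.range_comp_of_range_eq_top _ (LinearEquiv.range _)] at h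

theorem persymmetricRankCount_eq {n k : ℕ} (hk : 1 ≤ k) {i : ℕ} (hi : i ≤ k) :
    persymmetricRankCount n k (k - i) = {α : Fin n → Fin (k + 1) → ZMod 2 |
      finrank (ZMod 2) (hankelKernel k α) = i}.ncard := by
  rw [persymmetricRankCount, ← Set.ncard_image_of_injective _ (stackedHankel_injective hk)]
  congr 1
  ext M
  constructor
  · rintro ⟨⟨α, rfl⟩, h⟩
    have := rank_stackedHankel_add_finrank α
    exact ⟨α, show _ = _ by omega, rfl⟩
  · rintro ⟨α, h, rfl⟩
    have := rank_stackedHankel_add_finrank α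
    have h' : finrank (ZMod 2) (hankelKernel k α) = i := h
    exact ⟨⟨α, rfl⟩, by omega⟩

/-! ### The linear system for nine columns. -/

theorem sum_persymmetricRankCount_mul (n d : ℕ) (hd : d ≤ 9) :
    ∑ i ∈ Finset.range 10, (persymmetricRankCount n 9 (9 - i) : ℤ) * (gaussBinom 2 i d : ℕ) =
      ∑ i ∈ Finset.range (d + 1), (shiftCoreFormula 2 9 d i : ℤ) *
        (2 ^ n) ^ (10 - (2 * d - i)) := by
  have h := sum_ncard_hankelKernel_mul (F := ZMod 2) n 9 d
  rw [ZMod.card] at h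
  calc _ = ((∑ i ∈ Finset.range (9 + 1),
      {α : Fin n → Fin (9 + 1) → ZMod 2 | finrank (ZMod 2) (hankelKernel 9 α) = i}.ncard *
        gaussBinom 2 i d : ℕ) : ℤ) := by
        rw [Nat.cast_sum]
        refine Finset.sum_congr rfl fun i hi => ?_
        rw [persymmetricRankCount_eq (by norm_num)
          (Nat.lt_succ_iff.mp (Finset.mem_range.mp hi)), Nat.cast_mul]
    _ = _ := by
        rw [h, Nat.cast_sum]
        refine Finset.sum_congr rfl fun i hi => ?_
        rw [shiftCoreCount_zmod_two 9 le_rfl d (by omega) i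
          (Nat.lt_succ_iff.mp (Finset.mem_range.mp hi)), pow_right_comm]
        push_cast
        rfl

theorem mainTheorem1 (n : ℕ) (hn : 1 ≤ n) :
    (persymmetricRankCount n 9 0 : ℤ) = 1 ∧
    (persymmetricRankCount n 9 1 : ℤ) = (2 ^ n - 1) * 3 ∧
    (persymmetricRankCount n 9 2 : ℤ) = 7 * 2 ^ (2 * n) + 999 * 2 ^ n - 1006 ∧
    (persymmetricRankCount n 9 3 : ℤ) =
      15 * 2 ^ (3 * n) + 3451 * 2 ^ (2 * n) - 10458 * 2 ^ n + 6992 ∧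
    (persymmetricRankCount n 9 4 : ℤ) =
      31 * 2 ^ (4 * n) + 8355 * 2 ^ (3 * n) + 111118 * 2 ^ (2 * n) - 392304 * 2 ^ n + 272800 ∧
    (persymmetricRankCount n 9 5 : ℤ) =
      63 * 2 ^ (5 * n) + 17267 * 2 ^ (4 * n) + 356190 * 2 ^ (3 * n) - 3107440 * 2 ^ (2 * n)
        + 6568032 * 2 ^ n - 3834112 ∧
    (persymmetricRankCount n 9 6 : ℤ) =
      127 * 2 ^ (6 * n) + 31059 * 2 ^ (5 * n) + 492094 * 2 ^ (4 * n) - 6658800 * 2 ^ (3 * n)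
        + 24491488 * 2 ^ (2 * n) - 35215104 * 2 ^ n + 16859136 ∧
    (persymmetricRankCount n 9 7 : ℤ) =
      255 * 2 ^ (7 * n) + 42291 * 2 ^ (6 * n) - 219618 * 2 ^ (5 * n) - 4053808 * 2 ^ (4 * n)
        + 32840160 * 2 ^ (3 * n) - 82168576 * 2 ^ (2 * n) + 81543168 * 2 ^ n - 27983872 ∧
    (persymmetricRankCount n 9 8 : ℤ) =
      511 * 2 ^ (8 * n) - 765 * 2 ^ (7 * n) - 127762 * 2 ^ (6 * n) + 440496 * 2 ^ (5 * n)
        + 8456800 * 2 ^ (4 * n) - 57511680 * 2 ^ (3 * n) + 118013952 * 2 ^ (2 * n)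
        - 83951616 * 2 ^ n + 14680064 ∧
    (persymmetricRankCount n 9 9 : ℤ) =
      2 ^ (10 * n) - 511 * 2 ^ (8 * n) + 510 * 2 ^ (7 * n) + 85344 * 2 ^ (6 * n)
        - 252000 * 2 ^ (5 * n) - 4912384 * 2 ^ (4 * n) + 30965760 * 2 ^ (3 * n)
        - 57344000 * 2 ^ (2 * n) + 31457280 * 2 ^ n := by
  have h0 := sum_persymmetricRankCount_mul n 0 (by norm_num)
  have h1 := sum_persymmetricRankCount_mul n 1 (by norm_num)
  have h2 := sum_persymmetricRankCount_mul n 2 (by norm_num)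
  have h3 := sum_persymmetricRankCount_mul n 3 (by norm_num)
  have h4 := sum_persymmetricRankCount_mul n 4 (by norm_num)
  have h5 := sum_persymmetricRankCount_mul n 5 (by norm_num)
  have h6 := sum_persymmetricRankCount_mul n 6 (by norm_num)
  have h7 := sum_persymmetricRankCount_mul n 7 (by norm_num)
  have h8 := sum_persymmetricRankCount_mul n 8 (by norm_num)
  have h9 := sum_persymmetricRankCount_mul n 9 (by norm_num)
  -- With all coefficients evaluated, these are ten triangular equations, linear in the rank counts
  -- and the powers of `2 ^ n`. Equation `d = 9` involves rank `0` alone.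
  simp [Finset.sum_range_succ, shiftCoreFormula, gaussBinom] at h0 h1 h2 h3 h4 h5 h6 h7 h8 h9
  have hpow : ∀ c, (2 : ℤ) ^ (c * n) = (2 ^ n) ^ c := fun c => by rw [mul_comm, pow_mul]
  simp only [hpow]
  have h9' : (persymmetricRankCount n 9 0 : ℤ) = 1 := by exact_mod_cast h9
  refine ⟨h9', ?_, ?_, ?_, ?_, ?_, ?_, ?_, ?_, ?_⟩ <;> linarith
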